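/- Let $(\mathbf C_m,\Phi)$ be a finitely concrete mono category with an empty-like object: $\mathbf C_m$ is a category in which every morphism is a monomorphism, $\Phi:\mathbf C_m\to\mathbf{FinSet}_m$ is a faithful functor to the category of finite sets and injective functions, and there is an initial object $\hat\emptyset$ of $\mathbf C_m$ with $\Phi\hat\emptyset=\emptyset$. Suppose that $(\mathbf C_m,\Phi)$ satisfies the triangle condition: for all morphisms $f:X\to Z$, $g:Y\to Z$ of $\mathbf C_m$ and every injective function $\chi:\Phi X\to\Phi Y$ with $\Phi f=\Phi g\circ\chi$, there is a morphism $\phi:X\to Y$ with $f=g\circ\phi$. A filtration is a functor $F:(\mathbb R,\le)\to\mathbf C_m$, written $F_u$, $F_u^v:F_u\to F_v$. A real $a$ is a critical value of $F$ if every open interval containing $a$ contains $u\le v$ such that $F_u^v$ is not an isomorphism; $F$ is tame if it has finitely many critical values. For $\epsilon\ge 0$, $F$ and $G$ are $\epsilon$-interleaved if there are families of morphisms $\phi_w:F_w\to G_{w+\epsilon}$, $\psi_w:G_w\to F_{w+\epsilon}$ ($w\in\mathbb R$) with $\psi_{w+\epsilon}\phi_w=F_w^{w+2\epsilon}$, $\phi_{w+\epsilon}\psi_w=G_w^{w+2\epsilon}$,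 $\phi_vF_u^v=G_{u+\epsilon}^{v+\epsilon}\phi_u$ and $\psi_vG_u^v=F_{u+\epsilon}^{v+\epsilon}\psi_u$ for all $w$ and all $u\le v$. The interleaving distance $\delta(F,G)\in[0,\infty]$ is the infimum of such $\epsilon$ ($+\infty$ if there is none). A feature $\mathcal F$ is a set of pairs $(A,X)$, $X$ an object of $\mathbf C_m$ and $A\subseteq\Phi X$, such that $(A,X)\in\mathcal F\iff(\Phi f(A),X')\in\mathcal F$ for every isomorphism $f:X\to X'$. For a filtration $F$ and $u\le v$, let $S_F(u\le v)$ be the set of $A\subseteq\Phi F_u$ such that $(\Phi F_u^w(A),F_w)\in\mathcal F$ for all $w\in[u,v]$, and let $R_F(u\le v)$ be the set of $A\subseteq\Phi F_u$ for which there are $x\le u$, $y\ge v$ and $A'\subseteq\Phi F_x$ with $(A',F_x)\in\mathcal F$, $A=\Phi F_x^u(A')$ and $(\Phi F_u^y(A),F_y)\in\mathcal F$. The steady generator of $\mathcal F$ sends $F$ to the function $(u\le v)\mapsto|S_F(u\le v)|$, the ranging generator sends $F$ to $(u\le v)\mapsto|R_F(u\le v)|$. Let $\pi$ be either the steady or the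 ranging generator of $\mathcal F$. For $p=\pi(F)$, set $p=0$ whenever its first argument is $-\infty$ or its second argument is $+\infty$. For $u<v$ in $\mathbb R\cup\{\pm\infty\}$ the multiplicity $\mu(u,v)$ is the minimum, over disjoint connected neighbourhoods $I_u$, $I_v$ of $u$, $v$ in $\mathbb R\cup\{\pm\infty\}$, of $p(\sup I_u\le\inf I_v)-p(\inf I_u\le\inf I_v)-p(\sup I_u\le\sup I_v)+p(\inf I_u\le\sup I_v)$; the multiplicity of every diagonal point $(u,u)$ is (countably) infinite. The diagram $Dgm(p)$ is the multiset of points $(u,v)$, $u\le v$, with these multiplicities, and $d_B(p,p')=\inf_\gamma\sup_{c\in Dgm(p)}\|c-\gamma(c)\|_\infty$ over all bijections $\gamma:Dgm(p)\to Dgm(p')$ of multisets, where $|\infty-\infty|=0$ for equal infinities. Suppose that $\pi$ is balanced on tame filtrations: for every $\epsilon\ge0$ and all tame $\epsilon$-interleaved filtrations $F$, $G$, and all $u\le v$, $$\pi(F)(u-\epsilon\le v+\epsilon)\le\pi(G)(u\le v)\quad\text{and}\quad\pi(G)(u-\epsilon\le v+\epsilon)\le\pi(F)(u\le v).$$ Then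 $\pi$ is stable on tame filtrations: for all tame filtrations $F$ and $G$, $$d_B(\pi(F),\pi(G))\le\delta(F,G).$$ -/

import Mathlib

open CategoryTheory
open scoped ENNReal NNReal

universe u v w

namespace SteadyRanging

noncomputable section

/-! ### Finitely concrete mono categories -/

/-- A mono category: every morphism is a monomorphism. -/
def IsMonoCategory (C : Type u) [Category.{v} C] : Prop :=
  ∀ ⦃X Y : C⦄ (f : X ⟶ Y), Mono f

/-- Objects of the category of finite sets and injective functions. -/
structure FinSetMono : Type (w + 1) where
  carrier : Type w
  [finite : Finite carrier]

attribute [instance] FinSetMono.finite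

/-- The category of finite sets, whose morphisms are the injective functions. -/
instance : Category.{w} FinSetMono.{w} where
  Hom X Y := X.carrier ↪ Y.carrier
  id X := Function.Embedding.refl X.carrier
  comp f g := Function.Embedding.trans f g

section Concrete

variable {C : Type u} [Category.{v} C]

/-- The injective function `Φ f : Φ X → Φ Y` underlying a morphism `f : X ⟶ Y`. -/
def under (Φ : C ⥤ FinSetMono.{w}) {X Y : C} (f : X ⟶ Y) :
    (Φ.obj X).carrier ↪ (Φ.obj Y).carrier :=
  Φ.map f

theorem under_id (Φ : C ⥤ FinSetMono.{w}) (X : C) (x : (Φ.obj X).carrier) :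
    under Φ (𝟙 X) x = x := by
  unfold under
  rw [Φ.map_id]
  rfl

theorem under_comp (Φ : C ⥤ FinSetMono.{w}) {X Y Z : C} (f : X ⟶ Y) (g : Y ⟶ Z)
    (x : (Φ.obj X).carrier) : under Φ (f ≫ g) x = under Φ g (under Φ f x) := by
  unfold under
  rw [Φ.map_comp]
  rfl

/-- An empty-like object: an initial object whose underlying set is empty. -/
def IsEmptyLike (Φ : C ⥤ FinSetMono.{w}) (E : C) : Prop :=
  Nonempty (Limits.IsInitial E) ∧ IsEmpty (Φ.obj E).carrier

/-- The triangle condition: whenever `Φ f = Φ g ∘ χ` for an injective function `χ`,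
there is a morphism `φ` with `f = g ∘ φ`. -/
def TriangleCondition (Φ : C ⥤ FinSetMono.{w}) : Prop :=
  ∀ ⦃X Y Z : C⦄ (f : X ⟶ Z) (g : Y ⟶ Z) (χ : Φ.obj X ⟶ Φ.obj Y),
    Φ.map f = χ ≫ Φ.map g → ∃ φ : X ⟶ Y, f = φ ≫ g

/-- The image `Φ f (A)` of a subset `A ⊆ Φ X`. -/
def push (Φ : C ⥤ FinSetMono.{w}) {X Y : C} (f : X ⟶ Y) (A : Set (Φ.obj X).carrier) :
    Set (Φ.obj Y).carrier :=
  under Φ f '' A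

theorem push_id (Φ : C ⥤ FinSetMono.{w}) {X : C} (A : Set (Φ.obj X).carrier) :
    push Φ (𝟙 X) A = A := by
  ext x
  simp [push, under_id]

theorem push_push (Φ : C ⥤ FinSetMono.{w}) {X Y Z : C} (f : X ⟶ Y) (g : Y ⟶ Z)
    (A : Set (Φ.obj X).carrier) : push Φ g (push Φ f A) = push Φ (f ≫ g) A := by
  ext x
  simp [push, under_comp]

theorem push_injective (Φ : C ⥤ FinSetMono.{w}) {X Y : C} (f : X ⟶ Y) :
    Function.Injective (push Φ f) :=
  Set.image_injective.2 (under Φ f).injective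

/-- A feature: a set of pairs `(A, X)` with `A ⊆ Φ X`, invariant under isomorphisms.
`A ∈ 𝓕.sets X` means that the pair `(A, X)` belongs to the feature. -/
structure Feature (Φ : C ⥤ FinSetMono.{w}) where
  sets : ∀ X : C, Set (Set (Φ.obj X).carrier)
  iso_inv : ∀ ⦃X Y : C⦄ (f : X ⟶ Y), IsIso f →
    ∀ A : Set (Φ.obj X).carrier, A ∈ sets X ↔ push Φ f A ∈ sets Y

end Concrete

/-! ### Persistence functions, diagrams, bottleneck distance -/

/-- A persistence function, defined on the pairs `u ≤ v` of real numbers. -/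
structure PersistenceFunction where
  toFun : ∀ u v : ℝ, u ≤ v → ℤ
  mono_left : ∀ (u₁ u₂ v₁ : ℝ) (h : u₁ ≤ u₂) (h' : u₂ ≤ v₁),
    toFun u₁ v₁ (h.trans h') ≤ toFun u₂ v₁ h'
  anti_right : ∀ (u₂ v₁ v₂ : ℝ) (h : u₂ ≤ v₁) (h' : v₁ ≤ v₂),
    toFun u₂ v₂ (h.trans h') ≤ toFun u₂ v₁ h
  jump : ∀ (u₁ u₂ v₁ v₂ : ℝ) (h : u₁ ≤ u₂) (h' : u₂ ≤ v₁) (h'' : v₁ ≤ v₂),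
    toFun u₂ v₁ h' - toFun u₁ v₁ (h.trans h') ≥
      toFun u₂ v₂ (h'.trans h'') - toFun u₁ v₂ ((h.trans h').trans h'')

namespace PersistenceFunction

open Classical in
/-- Extension of a persistence function to infinite arguments, with value `0` there. -/
def ext (p : PersistenceFunction) (a b : EReal) : ℤ :=
  if h : ∃ u v : ℝ, u ≤ v ∧ a = u ∧ b = v then
    p.toFun h.choose h.choose_spec.choose h.choose_spec.choose_spec.1
  else 0

theorem ext_coe (p : PersistenceFunction) {u v : ℝ} (huv : u ≤ v) :
    p.ext (u : EReal) (v : EReal) = p.toFun u v huv := by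
  have h : ∃ u' v' : ℝ, u' ≤ v' ∧ (u : EReal) = u' ∧ (v : EReal) = v' := ⟨u, v, huv, rfl, rfl⟩
  have h1 : u = h.choose := EReal.coe_eq_coe_iff.1 h.choose_spec.choose_spec.2.1
  have h2 : v = h.choose_spec.choose := EReal.coe_eq_coe_iff.1 h.choose_spec.choose_spec.2.2
  unfold ext
  rw [dif_pos h]
  congr 1
  · exact h1.symm
  · exact h2.symm

theorem ext_bot_left (p : PersistenceFunction) (b : EReal) : p.ext ⊥ b = 0 := by
  unfold ext
  rw [dif_neg]
  rintro ⟨u, v, -, h, -⟩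
  exact EReal.coe_ne_bot u h.symm

theorem ext_top_right (p : PersistenceFunction) (a : EReal) : p.ext a ⊤ = 0 := by
  unfold ext
  rw [dif_neg]
  rintro ⟨u, v, -, -, h⟩
  exact EReal.coe_ne_top v h.symm

/-- The values over which the multiplicity of `(a, b)` is the minimum, as `I` and `J` run
over the disjoint connected neighbourhoods of `a` and `b` in `ℝ ∪ {-∞, +∞}`. -/
def multValues (p : PersistenceFunction) (a b : EReal) : Set ℤ :=
  {n | ∃ I J : Set EReal, I ∈ nhds a ∧ J ∈ nhds b ∧ _root_.IsConnected I ∧ _root_.IsConnected J ∧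
    Disjoint I J ∧
    n = p.ext (sSup I) (sInf J) - p.ext (sInf I) (sInf J)
      - p.ext (sSup I) (sSup J) + p.ext (sInf I) (sSup J)}

open Classical in
/-- The multiplicity of a point `(a, b)`: infinite on the diagonal, and `0` below it. -/
def mult (p : PersistenceFunction) (a b : EReal) : ℕ∞ :=
  if a = b then ⊤
  else if a < b then ((sInf (p.multValues a b)).toNat : ℕ∞)
  else 0

/-- The persistence diagram as a multiset: a point `c` occurs as `(c, 0), (c, 1), …`, as many
times as its multiplicity. -/
def Dgm (p : PersistenceFunction) : Type :=
  {x : (EReal × EReal) × ℕ // (x.2 : ℕ∞) < p.mult x.1.1 x.1.2}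

end PersistenceFunction

open Classical in
/-- `|a - b|` on the extended reals, with `|∞ - ∞| = 0`. -/
def erealDist (a b : EReal) : ℝ≥0∞ :=
  if a = b then 0 else (a - b).abs

/-- The extended `ℓ^∞` distance between two points of the extended plane. -/
def pointDist (c d : EReal × EReal) : ℝ≥0∞ :=
  max (erealDist c.1 d.1) (erealDist c.2 d.2)

/-- The bottleneck distance between (the diagrams of) two persistence functions. -/
def bottleneckDist (p q : PersistenceFunction) : ℝ≥0∞ :=
  ⨅ γ : p.Dgm ≃ q.Dgm, ⨆ c : p.Dgm, pointDist c.1.1 (γ c).1.1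

/-- `ε`-compatible persistence functions. -/
def Compatible (ε : ℝ≥0) (p q : PersistenceFunction) : Prop :=
  ∀ (u v : ℝ) (h : u ≤ v) (h' : u - ε ≤ v + ε),
    p.toFun (u - ε) (v + ε) h' ≤ q.toFun u v h ∧
    q.toFun (u - ε) (v + ε) h' ≤ p.toFun u v h

/-! ### Filtrations -/

section Filtrations

variable {C : Type u} [Category.{v} C]

/-- The structure morphism `F u ⟶ F v` of a filtration, for `u ≤ v`. -/
abbrev str (F : ℝ ⥤ C) {u v : ℝ} (h : u ≤ v) : F.obj u ⟶ F.obj v :=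
  F.map (homOfLE h)

/-- `a` is a critical value of `F`. -/
def IsCritical (F : ℝ ⥤ C) (a : ℝ) : Prop :=
  ∀ s t : ℝ, a ∈ Set.Ioo s t →
    ∃ (u v : ℝ) (h : u ≤ v), u ∈ Set.Ioo s t ∧ v ∈ Set.Ioo s t ∧ ¬ IsIso (str F h)

/-- A tame filtration: finitely many critical values. -/
def Tame (F : ℝ ⥤ C) : Prop :=
  {a : ℝ | IsCritical F a}.Finite

/-- `ε`-interleaved filtrations. The two triangles are indexed by their lower left corner. -/
def Interleaved (ε : ℝ≥0) (F G : ℝ ⥤ C) : Prop :=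
  ∃ (φ : ∀ w : ℝ, F.obj w ⟶ G.obj (w + ε)) (ψ : ∀ w : ℝ, G.obj w ⟶ F.obj (w + ε)),
    (∀ (w : ℝ) (h : w ≤ w + ε + ε), φ w ≫ ψ (w + ε) = str F h) ∧
    (∀ (w : ℝ) (h : w ≤ w + ε + ε), ψ w ≫ φ (w + ε) = str G h) ∧
    (∀ (u v : ℝ) (h : u ≤ v) (h' : u + ε ≤ v + ε), str F h ≫ φ v = φ u ≫ str G h') ∧
    (∀ (u v : ℝ) (h : u ≤ v) (h' : u + ε ≤ v + ε), str G h ≫ ψ v = ψ u ≫ str F h')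

/-- The interleaving distance (`∞` if the filtrations are not interleaved for any `ε`). -/
def interleavingDist (F G : ℝ ⥤ C) : ℝ≥0∞ :=
  ⨅ (ε : ℝ≥0) (_ : Interleaved ε F G), (ε : ℝ≥0∞)

/-- An ip-generator: a function from filtrations to persistence functions, invariant under
natural isomorphism. -/
structure IpGenerator (C : Type u) [Category.{v} C] where
  toFun : (ℝ ⥤ C) → PersistenceFunction
  iso_inv : ∀ F G : ℝ ⥤ C, Nonempty (F ≅ G) → toFun F = toFun G

/-- The balanced property on tame filtrations. -/
def IpGenerator.TameBalanced (π : IpGenerator C) : Prop :=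
  ∀ (ε : ℝ≥0) (F G : ℝ ⥤ C), Tame F → Tame G → Interleaved ε F G →
    Compatible ε (π.toFun F) (π.toFun G)

/-- The stability property on tame filtrations. -/
def IpGenerator.TameStable (π : IpGenerator C) : Prop :=
  ∀ F G : ℝ ⥤ C, Tame F → Tame G →
    bottleneckDist (π.toFun F) (π.toFun G) ≤ interleavingDist F G

end Filtrations

/-! ### Steady and ranging generators -/

section Generators

variable {C : Type u} [Category.{v} C] {Φ : C ⥤ FinSetMono.{w}}

theorem push_str (F : ℝ ⥤ C) {a b c : ℝ} (h : a ≤ b) (h' : b ≤ c)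
    (A : Set (Φ.obj (F.obj a)).carrier) :
    push Φ (str F h') (push Φ (str F h) A) = push Φ (str F (h.trans h')) A := by
  rw [push_push, ← F.map_comp]
  rfl

theorem push_str_refl (F : ℝ ⥤ C) {a : ℝ} (h : a ≤ a) (A : Set (Φ.obj (F.obj a)).carrier) :
    push Φ (str F h) A = A := by
  have : str F h = 𝟙 _ := F.map_id a
  rw [this, push_id]

/-- Steady sets at `u ≤ v`. -/
def steadySets (𝓕 : Feature Φ) (F : ℝ ⥤ C) (u v : ℝ) : Set (Set (Φ.obj (F.obj u)).carrier) :=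
  {A | ∀ (w : ℝ) (h : u ≤ w), w ≤ v → push Φ (str F h) A ∈ 𝓕.sets (F.obj w)}

/-- Ranging sets at `u ≤ v`. -/
def rangingSets (𝓕 : Feature Φ) (F : ℝ ⥤ C) (u v : ℝ) : Set (Set (Φ.obj (F.obj u)).carrier) :=
  {A | ∃ (x y : ℝ) (hx : x ≤ u) (_ : v ≤ y) (hy : u ≤ y) (A' : Set (Φ.obj (F.obj x)).carrier),
    A' ∈ 𝓕.sets (F.obj x) ∧ A = push Φ (str F hx) A' ∧ push Φ (str F hy) A ∈ 𝓕.sets (F.obj y)}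

/-- The persistence function `u ≤ v ↦ |S(u ≤ v)|` of a family of sets `S(u ≤ v)` of subsets of
`Φ F_u` with the inclusion properties that steady and ranging sets have. -/
def ofFamily (F : ℝ ⥤ C) (S : ∀ u _v : ℝ, Set (Set (Φ.obj (F.obj u)).carrier))
    (h1 : ∀ (u₁ u₂ v : ℝ) (h : u₁ ≤ u₂), u₂ ≤ v → ∀ A ∈ S u₁ v, push Φ (str F h) A ∈ S u₂ v)
    (h2 : ∀ (u v₁ v₂ : ℝ), u ≤ v₁ → v₁ ≤ v₂ → S u v₂ ⊆ S u v₁)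
    (h3 : ∀ (u₁ u₂ v₁ v₂ : ℝ) (h : u₁ ≤ u₂), u₂ ≤ v₁ → v₁ ≤ v₂ → ∀ A ∈ S u₁ v₁,
      push Φ (str F h) A ∈ S u₂ v₂ → A ∈ S u₁ v₂) : PersistenceFunction where
  toFun u v _ := ((S u v).ncard : ℤ)
  mono_left u₁ u₂ v h h' := by
    have : (S u₁ v).ncard ≤ (S u₂ v).ncard := by
      rw [← Set.ncard_image_of_injective (S u₁ v) (push_injective Φ (str F h))]
      apply Set.ncard_le_ncard _ (Set.toFinite _)
      rintro _ ⟨A, hA, rfl⟩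
      exact h1 u₁ u₂ v h h' A hA
    exact_mod_cast this
  anti_right u v₁ v₂ h h' := by
    have : (S u v₂).ncard ≤ (S u v₁).ncard :=
      Set.ncard_le_ncard (h2 u v₁ v₂ h h') (Set.toFinite _)
    exact_mod_cast this
  jump u₁ u₂ v₁ v₂ h h' h'' := by
    have key : ∀ v : ℝ, u₂ ≤ v →
        (((S u₂ v) \ (push Φ (str F h) '' S u₁ v)).ncard : ℤ)
          = (S u₂ v).ncard - (S u₁ v).ncard := by
      intro v hv
      have hsub : push Φ (str F h) '' S u₁ v ⊆ S u₂ v := by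
        rintro _ ⟨A, hA, rfl⟩
        exact h1 u₁ u₂ v h hv A hA
      have := Set.ncard_sdiff_add_ncard_of_subset hsub (Set.toFinite _)
      rw [Set.ncard_image_of_injective (S u₁ v) (push_injective Φ (str F h))] at this
      omega
    have hle : ((S u₂ v₂) \ (push Φ (str F h) '' S u₁ v₂)).ncard ≤
        ((S u₂ v₁) \ (push Φ (str F h) '' S u₁ v₁)).ncard := by
      apply Set.ncard_le_ncard _ (Set.toFinite _)
      rintro A ⟨hA, hA'⟩
      refine ⟨h2 u₂ v₁ v₂ h' h'' hA, ?_⟩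
      rintro ⟨B, hB, rfl⟩
      exact hA' ⟨B, h3 u₁ u₂ v₁ v₂ h h' h'' B hB hA, rfl⟩
    have k1 := key v₁ h'
    have k2 := key v₂ (h'.trans h'')
    have : (((S u₂ v₂) \ (push Φ (str F h) '' S u₁ v₂)).ncard : ℤ) ≤
        (((S u₂ v₁) \ (push Φ (str F h) '' S u₁ v₁)).ncard : ℤ) := by exact_mod_cast hle
    rw [k1, k2] at this
    exact this

/-- The steady function `u ≤ v ↦ |S(u ≤ v)|` of a filtration. -/
def steadyFunction (𝓕 : Feature Φ) (F : ℝ ⥤ C) : PersistenceFunction :=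
  ofFamily F (steadySets 𝓕 F)
    (by
      intro u₁ u₂ v h _ A hA w hw hwv
      rw [push_str]
      exact hA w (h.trans hw) hwv)
    (by
      intro u v₁ v₂ _ h A hA w hw hwv
      exact hA w hw (hwv.trans h))
    (by
      intro u₁ u₂ v₁ v₂ h h' _ A hA hA' w hw hwv
      by_cases hc : w ≤ v₁
      · exact hA w hw hc
      · have h2 : u₂ ≤ w := h'.trans (not_le.1 hc).le
        have := hA' w h2 hwv
        rwa [push_str] at this)

/-- The ranging function `u ≤ v ↦ |R(u ≤ v)|` of a filtration. -/
def rangingFunction (𝓕 : Feature Φ) (F : ℝ ⥤ C) : PersistenceFunction :=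
  ofFamily F (rangingSets 𝓕 F)
    (by
      rintro u₁ u₂ v h h' A ⟨x, y, hx, hv, hy, A', hA', rfl, hA⟩
      refine ⟨x, y, hx.trans h, hv, h'.trans hv, A', hA', push_str F hx h A', ?_⟩
      rw [push_str] at hA ⊢
      rwa [push_str])
    (by
      rintro u v₁ v₂ _ h A ⟨x, y, hx, hv, hy, A', hA', hA⟩
      exact ⟨x, y, hx, h.trans hv, hy, A', hA', hA⟩)
    (by
      rintro u₁ u₂ v₁ v₂ h h' _ A ⟨x, y, hx, _, _, A', hA', rfl, _⟩ ⟨_, y', _, hv', hy', _, _, _, hA⟩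
      refine ⟨x, y', hx, hv', h.trans hy', A', hA', rfl, ?_⟩
      rwa [push_str F h hy'] at hA)

theorem PersistenceFunction.eq_of_toFun {p q : PersistenceFunction}
    (h : ∀ (u v : ℝ) (huv : u ≤ v), p.toFun u v huv = q.toFun u v huv) : p = q := by
  cases p
  cases q
  congr
  funext u v huv
  exact h u v huv

/-- A natural isomorphism carries feature sets to feature sets. -/
theorem push_iso_mem (𝓕 : Feature Φ) {F G : ℝ ⥤ C} (e : F ≅ G) (u : ℝ)
    (A : Set (Φ.obj (F.obj u)).carrier) :
    push Φ (e.hom.app u) A ∈ 𝓕.sets (G.obj u) ↔ A ∈ 𝓕.sets (F.obj u) :=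
  (𝓕.iso_inv (e.hom.app u) inferInstance A).symm

theorem push_nat {F G : ℝ ⥤ C} (e : F ≅ G) {u v : ℝ} (h : u ≤ v)
    (A : Set (Φ.obj (F.obj u)).carrier) :
    push Φ (str G h) (push Φ (e.hom.app u) A) = push Φ (e.hom.app v) (push Φ (str F h) A) := by
  rw [push_push, push_push, e.hom.naturality]

theorem steadySets_iso (𝓕 : Feature Φ) {F G : ℝ ⥤ C} (e : F ≅ G) (u v : ℝ)
    (A : Set (Φ.obj (F.obj u)).carrier) (hA : A ∈ steadySets 𝓕 F u v) :
    push Φ (e.hom.app u) A ∈ steadySets 𝓕 G u v := by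
  intro w hw hwv
  rw [push_nat, push_iso_mem]
  exact hA w hw hwv

theorem rangingSets_iso (𝓕 : Feature Φ) {F G : ℝ ⥤ C} (e : F ≅ G) (u v : ℝ)
    (A : Set (Φ.obj (F.obj u)).carrier) (hA : A ∈ rangingSets 𝓕 F u v) :
    push Φ (e.hom.app u) A ∈ rangingSets 𝓕 G u v := by
  obtain ⟨x, y, hx, hv, hy, A', hA', rfl, h⟩ := hA
  refine ⟨x, y, hx, hv, hy, push Φ (e.hom.app x) A', (push_iso_mem 𝓕 e x A').2 hA',
    (push_nat e hx A').symm, ?_⟩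
  rw [push_nat, push_iso_mem]
  exact h

theorem ncard_le_of_push {X Y : C} (f : X ⟶ Y) (S : Set (Set (Φ.obj X).carrier))
    (T : Set (Set (Φ.obj Y).carrier)) (h : ∀ A ∈ S, push Φ f A ∈ T) : S.ncard ≤ T.ncard := by
  rw [← Set.ncard_image_of_injective S (push_injective Φ f)]
  apply Set.ncard_le_ncard _ (Set.toFinite _)
  rintro _ ⟨A, hA, rfl⟩
  exact h A hA

/-- The steady generator of a feature. -/
def steadyGenerator (𝓕 : Feature Φ) : IpGenerator C where
  toFun F := steadyFunction 𝓕 F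
  iso_inv F G := by
    rintro ⟨e⟩
    refine PersistenceFunction.eq_of_toFun fun u v _ => ?_
    have h1 := ncard_le_of_push (e.hom.app u) _ _ (steadySets_iso 𝓕 e u v)
    have h2 := ncard_le_of_push (e.symm.hom.app u) _ _ (steadySets_iso 𝓕 e.symm u v)
    exact congrArg Nat.cast (le_antisymm h1 h2)

/-- The ranging generator of a feature. -/
def rangingGenerator (𝓕 : Feature Φ) : IpGenerator C where
  toFun F := rangingFunction 𝓕 F
  iso_inv F G := by
    rintro ⟨e⟩
    refine PersistenceFunction.eq_of_toFun fun u v _ => ?_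
    have h1 := ncard_le_of_push (e.hom.app u) _ _ (rangingSets_iso 𝓕 e u v)
    have h2 := ncard_le_of_push (e.symm.hom.app u) _ _ (rangingSets_iso 𝓕 e.symm u v)
    exact congrArg Nat.cast (le_antisymm h1 h2)

end Generators

end

end SteadyRanging

/-!
A generator that is balanced on tame filtrations has convex features: comparing step filtrations
that differ by one object shows that, for `X₁ ⟶ X₂ ⟶ X₃`, a set which is a feature at `X₁` and at
`X₃` is a feature at `X₂` (for the ranging generator this may fail, but only for sets that are
features both at an earlier and at a later object). Interleaved tame filtrations map compatibly to a
common object `V`, so both persistence functions count bars indexed by the subsets of `Φ V`, and by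
convexity the two bars of each subset differ by at most `ε`. The bijection of diagrams comes from
the Schröder-Bernstein theorem. The argument needs neither an empty-like object nor the triangle
condition.
-/

/-! Let `F` and `G` be tame and `ε`-interleaved. Since `F` is eventually constant up to isomorphism,
it maps to its final object `V`, and `G` maps to `V` through the interleaving. All underlying maps
are injective, so a subset of `Φ F_u` or `Φ G_u` is determined by its image `B ⊆ Φ V`. Both
generators then count subsets `B` by the times at which they are feature sets: the ranging function
counts the interval hulls of these lives (`hasBars_rangingFunction`), and the steady function counts
the lives themselves once they are known to be intervals (`hasBars_steadyFunction`). Thus `F` and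
`G` have finite barcodes indexed by the same set, the subsets of `Φ V`.

It remains to compare the two bars of a single `B`. Balancedness is an inequality between numbers,
but for two step filtrations through the same chain of objects one of the counted families can be
made to contain the other. The inequality then forces the two finite families to be equal, and this
equality is a statement about each single `B` (`steady_convex`, `ranging_alive_birth`,
`ranging_alive_death`). Applied to the zigzags `F x ⟶ G z ⟶ F y` over `V`, it shows that each bar,
shortened by `ε` at both ends, lies in its partner (`Shifts.steady_shrinkLE`,
`Shifts.ranging_shrinkLE`).

The rest is combinatorics of barcodes. Multiplicities count bars with given endpoints
(`HasBars.isLeast_multValues`), bars longer than `2ε` have partners with endpoints within `ε`, and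
shorter ones are close to the diagonal. This gives injections both ways, which Schröder-Bernstein
merges into one bijection with the same bound. -/

namespace SteadyRanging

/-! ### Extended endpoints of sets of reals -/

/-- The infimum of a set of reals in the extended reals. -/
noncomputable def lo (S : Set ℝ) : EReal := sInf ((↑) '' S)

/-- The supremum of a set of reals in the extended reals. -/
noncomputable def hi (S : Set ℝ) : EReal := sSup ((↑) '' S)

theorem lo_le {S : Set ℝ} {x : ℝ} (hx : x ∈ S) : lo S ≤ x := sInf_le ⟨x, hx, rfl⟩

theorem le_hi {S : Set ℝ} {x : ℝ} (hx : x ∈ S) : (x : EReal) ≤ hi S := le_sSup ⟨x, hx, rfl⟩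

theorem le_lo {S : Set ℝ} {a : EReal} (h : ∀ x ∈ S, a ≤ (x : EReal)) : a ≤ lo S :=
  le_sInf (by rintro _ ⟨x, hx, rfl⟩; exact h x hx)

theorem hi_le {S : Set ℝ} {a : EReal} (h : ∀ x ∈ S, (x : EReal) ≤ a) : hi S ≤ a :=
  sSup_le (by rintro _ ⟨x, hx, rfl⟩; exact h x hx)

theorem nonempty_of_lo_lt_hi {S : Set ℝ} (h : lo S < hi S) : S.Nonempty := by
  rw [Set.nonempty_iff_ne_empty]
  rintro rfl
  simp [lo, hi] at h

theorem ordConnected_coe_image {S : Set ℝ} (hS : S.OrdConnected) :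
    ((↑) '' S : Set EReal).OrdConnected := by
  refine ⟨?_⟩
  rintro _ ⟨x, hx, rfl⟩ _ ⟨z, hz, rfl⟩ y ⟨h1, h2⟩
  induction y using EReal.rec with
  | bot => simp at h1
  | top => simp at h2
  | coe y => exact ⟨y, hS.out hx hz ⟨by exact_mod_cast h1, by exact_mod_cast h2⟩, rfl⟩

theorem mem_coe_image_of_lo_lt_of_lt_hi {S : Set ℝ} (hS : S.OrdConnected) {y : EReal}
    (h1 : lo S < y) (h2 : y < hi S) : y ∈ ((↑) '' S : Set EReal) := by
  obtain ⟨x, hx, hxy⟩ := sInf_lt_iff.1 h1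
  obtain ⟨z, hz, hyz⟩ := lt_sSup_iff.1 h2
  exact (ordConnected_coe_image hS).out hx hz ⟨hxy.le, hyz.le⟩

theorem lt_sSup_of_mem_nhds {a : EReal} {I : Set EReal} (hI : I ∈ nhds a) (ha : a ≠ ⊤) :
    a < sSup I := by
  obtain ⟨u, hu, hsub⟩ := exists_Ico_subset_of_mem_nhds hI ⟨⊤, lt_top_iff_ne_top.2 ha⟩
  obtain ⟨c, hac, hcu⟩ := exists_between hu
  exact hac.trans_le (le_sSup (hsub ⟨hac.le, hcu⟩))

theorem sInf_lt_of_mem_nhds {a : EReal} {I : Set EReal} (hI : I ∈ nhds a) (ha : a ≠ ⊥) :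
    sInf I < a := by
  obtain ⟨l, hl, hsub⟩ := exists_Ioc_subset_of_mem_nhds hI ⟨⊥, bot_lt_iff_ne_bot.2 ha⟩
  obtain ⟨c, hlc, hca⟩ := exists_between hl
  exact (sInf_le (hsub ⟨hlc, hca.le⟩)).trans_lt hca

/-- The left end of `I` is strictly below `lo S`, or else both are `⊥`, which is not a real number.
So infinite endpoints need no separate treatment later. -/
theorem notMem_coe_image_of_nhds_lo {S : Set ℝ} {I : Set EReal} (hI : I ∈ nhds (lo S)) :
    sInf I ∉ ((↑) '' S : Set EReal) := by
  intro h
  have hle : lo S ≤ sInf I := sInf_le h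
  by_cases hb : lo S = ⊥
  · rw [hb] at hI
    obtain ⟨x, -, hx⟩ := h
    rw [sInf_eq_bot.2 fun b hb => ⟨⊥, mem_of_mem_nhds hI, hb⟩] at hx
    exact EReal.coe_ne_bot x hx
  · exact absurd (sInf_lt_of_mem_nhds hI hb) (not_lt.2 hle)

theorem notMem_coe_image_of_nhds_hi {S : Set ℝ} {I : Set EReal} (hI : I ∈ nhds (hi S)) :
    sSup I ∉ ((↑) '' S : Set EReal) := by
  intro h
  have hle : sSup I ≤ hi S := le_sSup h
  by_cases hb : hi S = ⊤
  · rw [hb] at hI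
    obtain ⟨x, -, hx⟩ := h
    rw [sSup_eq_top.2 fun b hb => ⟨⊤, mem_of_mem_nhds hI, hb⟩] at hx
    exact EReal.coe_ne_top x hx
  · exact absurd (lt_sSup_of_mem_nhds hI hb) (not_lt.2 hle)

theorem mem_coe_image_of_nhds {S : Set ℝ} (hS : S.OrdConnected) {I K : Set EReal}
    (hI : I ∈ nhds (lo S)) (hK : K ∈ nhds (hi S)) (hlt : lo S < hi S) (hle : sSup I ≤ sInf K) :
    (sSup I ∈ ((↑) '' S : Set EReal) ∧ sInf K ∈ ((↑) '' S : Set EReal)) ∧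
      sInf I ∉ ((↑) '' S : Set EReal) ∧ sSup K ∉ ((↑) '' S : Set EReal) := by
  have h1 := lt_sSup_of_mem_nhds hI hlt.ne_top
  have h2 := sInf_lt_of_mem_nhds hK hlt.ne_bot
  exact ⟨⟨mem_coe_image_of_lo_lt_of_lt_hi hS h1 (hle.trans_lt h2),
    mem_coe_image_of_lo_lt_of_lt_hi hS (h1.trans_le hle) h2⟩,
    notMem_coe_image_of_nhds_lo hI, notMem_coe_image_of_nhds_hi hK⟩

theorem sSup_le_sInf_of_disjoint {a b : EReal} (hab : a < b) {I K : Set EReal} (ha : a ∈ I)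
    (hb : b ∈ K) (hI : _root_.IsConnected I) (hK : _root_.IsConnected K) (h : Disjoint I K) :
    sSup I ≤ sInf K := by
  refine sSup_le fun x hx => le_sInf fun y hy => ?_
  by_contra hlt
  rw [not_le] at hlt
  have hIo := hI.isPreconnected.ordConnected
  have hKo := hK.isPreconnected.ordConnected
  rw [Set.disjoint_left] at h
  rcases le_total y a with hya | hay
  · exact h ha (hKo.out hy hb ⟨hya, hab.le⟩)
  · exact h (hIo.out ha hx ⟨hay, hlt.le⟩) hy

/-! ### Persistence functions with a finite barcode -/

/-- `p` counts the bars of the barcode `J`. -/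
def HasBars {ι : Type*} (p : PersistenceFunction) (J : ι → Set ℝ) : Prop :=
  ∀ (u v : ℝ) (h : u ≤ v), p.toFun u v h = ({i | u ∈ J i ∧ v ∈ J i}.ncard : ℤ)

section Bars

variable {ι : Type*} {p : PersistenceFunction} {J : ι → Set ℝ}

theorem HasBars.ext_eq (hp : HasBars p J) {x y : EReal} (hxy : x ≤ y) :
    p.ext x y = ({i | x ∈ ((↑) '' J i : Set EReal) ∧ y ∈ ((↑) '' J i : Set EReal)}.ncard : ℤ) := by
  induction x using EReal.rec with
  | bot => simp [p.ext_bot_left]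
  | top =>
    rw [top_le_iff] at hxy
    subst hxy
    simp [p.ext_top_right]
  | coe x =>
    induction y using EReal.rec with
    | bot => simp at hxy
    | top => simp [p.ext_top_right]
    | coe y =>
      have h : x ≤ y := by exact_mod_cast hxy
      rw [p.ext_coe h, hp]
      simp

/-- Inclusion-exclusion: convexity places the bars through `s₁, t₁` and those through `s₂, t₂` among
the bars through `s₂, t₁`, and their common members are the bars through `s₁, t₂`. -/
theorem HasBars.alternating_sum_eq [Finite ι] (hp : HasBars p J) (hJ : ∀ i, (J i).OrdConnected)
    {s₁ s₂ t₁ t₂ : EReal} (hs : s₁ ≤ s₂) (hst : s₂ ≤ t₁) (ht : t₁ ≤ t₂) :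
    p.ext s₂ t₁ - p.ext s₁ t₁ - p.ext s₂ t₂ + p.ext s₁ t₂ =
      ({i | (s₂ ∈ ((↑) '' J i : Set EReal) ∧ t₁ ∈ ((↑) '' J i : Set EReal)) ∧
        s₁ ∉ ((↑) '' J i : Set EReal) ∧ t₂ ∉ ((↑) '' J i : Set EReal)}.ncard : ℤ) := by
  rw [hp.ext_eq hst, hp.ext_eq (hs.trans hst), hp.ext_eq (hst.trans ht),
    hp.ext_eq ((hs.trans hst).trans ht)]
  set E : ι → Set EReal := fun i => ((↑) '' J i : Set EReal)
  set A := {i | s₂ ∈ E i ∧ t₁ ∈ E i}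
  set B := {i | s₁ ∈ E i ∧ t₁ ∈ E i}
  set D := {i | s₂ ∈ E i ∧ t₂ ∈ E i}
  have hE : ∀ i, (E i).OrdConnected := fun i => ordConnected_coe_image (hJ i)
  have hsub : B ∪ D ⊆ A := by
    rintro i (⟨h1, h2⟩ | ⟨h1, h2⟩)
    · exact ⟨(hE i).out h1 h2 ⟨hs, hst⟩, h2⟩
    · exact ⟨h1, (hE i).out h1 h2 ⟨hst, ht⟩⟩
  have hinter : B ∩ D = {i | s₁ ∈ E i ∧ t₂ ∈ E i} := by
    ext i
    constructor
    · rintro ⟨⟨h1, _⟩, _, h4⟩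
      exact ⟨h1, h4⟩
    · rintro ⟨h1, h2⟩
      exact ⟨⟨h1, (hE i).out h1 h2 ⟨hs.trans hst, ht⟩⟩,
        (hE i).out h1 h2 ⟨hs, hst.trans ht⟩, h2⟩
  have hdiff : {i | (s₂ ∈ E i ∧ t₁ ∈ E i) ∧ s₁ ∉ E i ∧ t₂ ∉ E i} = A \ (B ∪ D) := by
    ext i
    simp only [A, B, D, Set.mem_sdiff, Set.mem_union, Set.mem_ofPred_eq]
    tauto
  rw [hdiff, ← hinter]
  have h1 := Set.ncard_union_add_ncard_inter B D
  have h2 := Set.ncard_sdiff_add_ncard_of_subset hsub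
  omega

/-- Every admissible pair of neighbourhoods counts all bars with endpoints exactly `a` and `b`.
Neighbourhoods small enough to miss the finitely many other endpoints count nothing else, so the
minimum is attained. -/
theorem HasBars.isLeast_multValues [Finite ι] (hp : HasBars p J) (hJ : ∀ i, (J i).OrdConnected)
    {a b : EReal} (hab : a < b) :
    IsLeast (p.multValues a b) ({i | lo (J i) = a ∧ hi (J i) = b}.ncard : ℤ) := by
  constructor
  · obtain ⟨m, ham, hmb⟩ := exists_between hab
    have hU : ({x | ∃ i, lo (J i) = x ∧ x ≠ a}ᶜ ∩ Set.Iio m : Set EReal) ∈ nhds a := by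
      refine Filter.inter_mem ?_ (Iio_mem_nhds ham)
      have : ({x | ∃ i, lo (J i) = x ∧ x ≠ a} : Set EReal).Finite :=
        (Set.finite_range fun i => lo (J i)).subset (by rintro x ⟨i, rfl, -⟩; exact ⟨i, rfl⟩)
      exact this.isClosed.isOpen_compl.mem_nhds (by rintro ⟨i, -, h⟩; exact h rfl)
    have hV : ({x | ∃ i, hi (J i) = x ∧ x ≠ b}ᶜ ∩ Set.Ioi m : Set EReal) ∈ nhds b := by
      refine Filter.inter_mem ?_ (Ioi_mem_nhds hmb)
      have : ({x | ∃ i, hi (J i) = x ∧ x ≠ b} : Set EReal).Finite :=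
        (Set.finite_range fun i => hi (J i)).subset (by rintro x ⟨i, rfl, -⟩; exact ⟨i, rfl⟩)
      exact this.isClosed.isOpen_compl.mem_nhds (by rintro ⟨i, -, h⟩; exact h rfl)
    obtain ⟨s₁, s₂, has, hs, hsU⟩ := exists_Icc_mem_subset_of_mem_nhds hU
    obtain ⟨t₁, t₂, hbt, ht, htV⟩ := exists_Icc_mem_subset_of_mem_nhds hV
    have hs12 : s₁ ≤ s₂ := has.1.trans has.2
    have ht12 : t₁ ≤ t₂ := hbt.1.trans hbt.2
    have hs2 : s₂ < m := (hsU ⟨hs12, le_rfl⟩).2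
    have ht1 : m < t₁ := (htV ⟨le_rfl, ht12⟩).2
    refine ⟨Set.Icc s₁ s₂, Set.Icc t₁ t₂, hs, ht, isConnected_Icc hs12, isConnected_Icc ht12, ?_, ?_⟩
    · rw [Set.disjoint_left]
      rintro x ⟨-, h1⟩ ⟨h2, -⟩
      exact absurd (h2.trans h1) (not_le.2 (hs2.trans ht1))
    · rw [csInf_Icc hs12, csSup_Icc hs12, csInf_Icc ht12, csSup_Icc ht12,
        hp.alternating_sum_eq hJ hs12 (hs2.trans ht1).le ht12]
      congr 2
      ext i
      have hE := ordConnected_coe_image (hJ i)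
      constructor
      · rintro ⟨rfl, rfl⟩
        have h := mem_coe_image_of_nhds (hJ i) hs ht hab
        rw [csInf_Icc hs12, csSup_Icc hs12, csInf_Icc ht12, csSup_Icc ht12] at h
        exact h (hs2.trans ht1).le
      · rintro ⟨⟨h1, h2⟩, h3, h4⟩
        constructor
        · by_contra hne
          -- The bar contains `s₂` but not `s₁`, so its left end lies in `[s₁, s₂]`, where `a` is
          -- the only left endpoint allowed.
          refine (hsU ⟨?_, sInf_le h1⟩ : lo (J i) ∈ _).1 ⟨i, rfl, hne⟩
          refine le_lo fun x hx => ?_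
          by_contra hlt
          exact h3 (hE.out ⟨x, hx, rfl⟩ h1 ⟨(not_le.1 hlt).le, hs12⟩)
        · by_contra hne
          refine (htV ⟨le_sSup h2, ?_⟩ : hi (J i) ∈ _).1 ⟨i, rfl, hne⟩
          refine hi_le fun x hx => ?_
          by_contra hlt
          exact h4 (hE.out h2 ⟨x, hx, rfl⟩ ⟨ht12, (not_le.1 hlt).le⟩)
  · rintro n ⟨I, K, hI, hK, hIc, hKc, hd, rfl⟩
    have hle := sSup_le_sInf_of_disjoint hab (mem_of_mem_nhds hI) (mem_of_mem_nhds hK) hIc hKc hd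
    rw [hp.alternating_sum_eq hJ (sInf_le_sSup hIc.nonempty) hle (sInf_le_sSup hKc.nonempty)]
    refine Nat.cast_le.2 (Set.ncard_le_ncard ?_ (Set.toFinite _))
    rintro i ⟨rfl, rfl⟩
    exact mem_coe_image_of_nhds (hJ i) hI hK hab hle

theorem HasBars.mult_eq [Finite ι] (hp : HasBars p J) (hJ : ∀ i, (J i).OrdConnected)
    {a b : EReal} (hab : a < b) :
    p.mult a b = ({i | lo (J i) = a ∧ hi (J i) = b}.ncard : ℕ∞) := by
  unfold PersistenceFunction.mult
  rw [if_neg hab.ne, if_pos hab, (hp.isLeast_multValues hJ hab).csInf_eq, Int.toNat_natCast]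

theorem mult_self (p : PersistenceFunction) (a : EReal) : p.mult a a = ⊤ := by
  simp [PersistenceFunction.mult]

theorem le_of_lt_mult {p : PersistenceFunction} {a b : EReal} {n : ℕ∞} (h : n < p.mult a b) :
    a ≤ b := by
  unfold PersistenceFunction.mult at h
  split_ifs at h with h1 h2
  · exact h1.le
  · exact h2.le
  · simp at h

/-- A diagram consists of the bars of positive length and of the diagonal points. -/
theorem HasBars.exists_equiv [Finite ι] (hp : HasBars p J) (hJ : ∀ i, (J i).OrdConnected) :
    ∃ e : {i // lo (J i) < hi (J i)} ⊕ (EReal × ℕ) ≃ p.Dgm,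
      (∀ i, (e (Sum.inl i)).1.1 = (lo (J i.1), hi (J i.1))) ∧
        ∀ d, (e (Sum.inr d)).1.1 = (d.1, d.1) := by
  classical
  -- Numbering the bars that share the endpoints `c` supplies the copy index of a diagram point.
  let e' : ∀ c : EReal × EReal, {i | lo (J i) = c.1 ∧ hi (J i) = c.2} ≃
      Fin ({i | lo (J i) = c.1 ∧ hi (J i) = c.2}.ncard) := fun c =>
    Finite.equivFinOfCardEq rfl
  let f : {i // lo (J i) < hi (J i)} ⊕ (EReal × ℕ) → p.Dgm := Sum.elim
    (fun i => ⟨((lo (J i.1), hi (J i.1)), (e' (lo (J i.1), hi (J i.1)) ⟨i.1, rfl, rfl⟩ : ℕ)), by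
      rw [hp.mult_eq hJ i.2]
      exact_mod_cast Fin.is_lt _⟩)
    (fun d => ⟨((d.1, d.1), d.2), by rw [mult_self]; exact WithTop.coe_lt_top _⟩)
  have hf : Function.Bijective f := by
    constructor
    · rintro (i | d) (j | d') h
      · have h1 : (lo (J i.1), hi (J i.1)) = (lo (J j.1), hi (J j.1)) :=
          congrArg (fun x : p.Dgm => x.1.1) h
        have h2 : (e' (lo (J i.1), hi (J i.1)) ⟨i.1, rfl, rfl⟩ : ℕ) =
            (e' (lo (J j.1), hi (J j.1)) ⟨j.1, rfl, rfl⟩ : ℕ) :=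
          congrArg (fun x : p.Dgm => x.1.2) h
        -- The type of `e' c` depends on `c`, so the equality of endpoints must be substituted
        -- before injectivity applies.
        have key : ∀ (c c' : EReal × EReal) (hc : c = c') (x : {i | lo (J i) = c.1 ∧ hi (J i) = c.2})
            (y : {i | lo (J i) = c'.1 ∧ hi (J i) = c'.2}), (e' c x : ℕ) = e' c' y →
            x.1 = y.1 := by
          rintro c _ rfl x y hxy
          rw [(e' c).injective (Fin.ext hxy)]
        exact congrArg Sum.inl (Subtype.ext (key _ _ h1 _ _ h2))
      · have h1 : (lo (J i.1), hi (J i.1)) = (d'.1, d'.1) := congrArg (fun x : p.Dgm => x.1.1) h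
        exact absurd ((congrArg Prod.fst h1).trans (congrArg Prod.snd h1).symm) i.2.ne
      · have h1 : (d.1, d.1) = (lo (J j.1), hi (J j.1)) := congrArg (fun x : p.Dgm => x.1.1) h
        exact absurd ((congrArg Prod.fst h1).symm.trans (congrArg Prod.snd h1)) j.2.ne
      · have h1 : (d.1, d.1) = (d'.1, d'.1) := congrArg (fun x : p.Dgm => x.1.1) h
        have h2 : d.2 = d'.2 := congrArg (fun x : p.Dgm => x.1.2) h
        exact congrArg Sum.inr (Prod.ext (Prod.mk.inj h1).1 h2)
    · rintro ⟨⟨⟨a, b⟩, n⟩, hn⟩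
      rcases (le_of_lt_mult hn).eq_or_lt with h | h
      · obtain rfl : a = b := h
        exact ⟨Sum.inr (a, n), rfl⟩
      · change a < b at h
        have hn' := hn
        simp only [hp.mult_eq hJ h] at hn'
        obtain ⟨x, hx⟩ := (e' (a, b)).surjective ⟨n, by exact_mod_cast hn'⟩
        obtain ⟨i, hib⟩ := x
        have h1 : lo (J i) = a := hib.1
        have h2 : hi (J i) = b := hib.2
        subst h1 h2
        refine ⟨Sum.inl ⟨i, h⟩, Subtype.ext (Prod.ext rfl ?_)⟩
        exact congrArg Fin.val hx
  exact ⟨Equiv.ofBijective f hf, fun i => rfl, fun d => rfl⟩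

end Bars

/-! ### Distances in the extended plane -/

/-- `a` and `b` differ by at most `ε`. -/
def Near (ε : ℝ≥0) (a b : EReal) : Prop :=
  a ≤ b + ((ε : ℝ) : EReal) ∧ b ≤ a + ((ε : ℝ) : EReal)

theorem Near.symm {ε : ℝ≥0} {a b : EReal} (h : Near ε a b) : Near ε b a := ⟨h.2, h.1⟩

theorem Near.refl (ε : ℝ≥0) (a : EReal) : Near ε a a := by
  have : a ≤ a + ((ε : ℝ) : EReal) := le_add_of_nonneg_right (by exact_mod_cast ε.2)
  exact ⟨this, this⟩

theorem Near.erealDist_le {ε : ℝ≥0} {a b : EReal} (h : Near ε a b) : erealDist a b ≤ ε := by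
  unfold erealDist
  split_ifs with hab
  · exact bot_le
  · obtain ⟨h1, h2⟩ := h
    induction a using EReal.rec with
    | bot => simp_all
    | top =>
      exact absurd (top_le_iff.1 h1) (by
        induction b using EReal.rec with
        | bot => simp
        | top => exact absurd rfl hab
        | coe y => exact_mod_cast EReal.coe_ne_top _)
    | coe x =>
      induction b using EReal.rec with
      | bot => simp at h1
      | top => exact absurd (top_le_iff.1 h2) (by exact_mod_cast EReal.coe_ne_top _)
      | coe y =>
        have h1' : x ≤ y + ε := by exact_mod_cast h1
        have h2' : y ≤ x + ε := by exact_mod_cast h2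
        rw [← EReal.coe_sub, EReal.abs_def, ← ENNReal.ofReal_coe_nnreal]
        exact ENNReal.ofReal_le_ofReal (abs_le.2 ⟨by linarith, by linarith⟩)

/-- The bars of `T` contain those of `S`, shortened by `ε` at both ends. -/
def ShrinkLE (ε : ℝ≥0) (S T : Set ℝ) : Prop :=
  ∀ x ∈ S, ∀ y ∈ S, ∀ z : ℝ, x + ε ≤ z → z ≤ y - ε → z ∈ T

theorem lo_le_lo_add {ε : ℝ≥0} {S T : Set ℝ} (h : ∀ x ∈ S, ∃ y ∈ T, y ≤ x + ε) :
    lo T ≤ lo S + ((ε : ℝ) : EReal) := by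
  -- As `ε` is finite it can be moved across, leaving a bare infimum on the right.
  rw [← EReal.sub_le_iff_le_add (by simp) (by simp)]
  refine le_lo fun x hx => ?_
  rw [EReal.sub_le_iff_le_add (by simp) (by simp)]
  obtain ⟨y, hy, hyx⟩ := h x hx
  exact (lo_le hy).trans (by exact_mod_cast hyx)

theorem hi_le_hi_add {ε : ℝ≥0} {S T : Set ℝ} (h : ∀ x ∈ S, ∃ y ∈ T, x ≤ y + ε) :
    hi S ≤ hi T + ((ε : ℝ) : EReal) := by
  refine hi_le fun x hx => ?_
  obtain ⟨y, hy, hyx⟩ := h x hx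
  have : (x : EReal) ≤ y + ((ε : ℝ) : EReal) := by exact_mod_cast hyx
  exact this.trans (by gcongr; exact le_hi hy)

/-- A bar longer than `2ε` leaves two distinct points `x₀ + ε < y₀ - ε` in its partner. They anchor
the comparison: a point of one bar that lies farther out than the anchor, moved inwards by `ε`,
falls in the other bar. -/
theorem ShrinkLE.near {ε : ℝ≥0} {S T : Set ℝ} (hST : ShrinkLE ε S T) (hTS : ShrinkLE ε T S)
    {x₀ y₀ : ℝ} (hx : x₀ ∈ S) (hy : y₀ ∈ S) (hxy : x₀ + 2 * ε < y₀) :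
    lo T < hi T ∧ Near ε (lo S) (lo T) ∧ Near ε (hi S) (hi T) := by
  have hε : (0 : ℝ) ≤ ε := ε.2
  have hx' : x₀ + ε ∈ T := hST x₀ hx y₀ hy _ le_rfl (by linarith)
  have hy' : y₀ - ε ∈ T := hST x₀ hx y₀ hy _ (by linarith) le_rfl
  refine ⟨(lo_le hx').trans_lt (lt_of_lt_of_le ?_ (le_hi hy')), ⟨?_, ?_⟩, ?_, ?_⟩
  · exact_mod_cast (by linarith : x₀ + ε < y₀ - ε)
  · refine lo_le_lo_add fun x hxT => ?_
    rcases le_total x₀ (x + ε) with h | h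
    · exact ⟨x₀, hx, h⟩
    · exact ⟨x + ε, hTS x hxT _ hy' _ le_rfl (by linarith), le_rfl⟩
  · refine lo_le_lo_add fun x hxS => ?_
    rcases le_total (x₀ + ε) (x + ε) with h | h
    · exact ⟨x₀ + ε, hx', h⟩
    · exact ⟨x + ε, hST x hxS y₀ hy _ le_rfl (by linarith), le_rfl⟩
  · refine hi_le_hi_add fun x hxS => ?_
    rcases le_total (x - ε) (y₀ - ε) with h | h
    · exact ⟨y₀ - ε, hy', by linarith⟩
    · exact ⟨x - ε, hST x₀ hx x hxS _ (by linarith) le_rfl, by linarith⟩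
  · refine hi_le_hi_add fun x hxT => ?_
    rcases le_total (x - ε) y₀ with h | h
    · exact ⟨y₀, hy, by linarith⟩
    · exact ⟨x - ε, hTS _ hx' x hxT _ (by linarith) le_rfl, by linarith⟩

/-- A short bar is close to a diagonal point. -/
theorem exists_near_of_short {ε : ℝ≥0} {S : Set ℝ} (hS : lo S < hi S)
    (h : ∀ x ∈ S, ∀ y ∈ S, y ≤ x + 2 * ε) : ∃ m : EReal, Near ε (lo S) m ∧ Near ε (hi S) m := by
  obtain ⟨x₀, hx₀⟩ := nonempty_of_lo_lt_hi hS
  obtain ⟨a, ha⟩ : ∃ a : ℝ, lo S = a := by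
    have h1 : lo S ≤ x₀ := lo_le hx₀
    have h2 : ((x₀ - 2 * ε : ℝ) : EReal) ≤ lo S := le_lo fun x hx => by
      exact_mod_cast (by linarith [h x hx x₀ hx₀] : x₀ - 2 * ε ≤ x)
    exact ⟨(lo S).toReal, (EReal.coe_toReal (ne_top_of_le_ne_top (EReal.coe_ne_top _) h1)
      (ne_bot_of_le_ne_bot (EReal.coe_ne_bot _) h2)).symm⟩
  have hle : hi S ≤ ((a + 2 * ε : ℝ) : EReal) := by
    refine hi_le fun y hy => ?_
    have : ((y - 2 * ε : ℝ) : EReal) ≤ lo S := le_lo fun x hx => by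
      exact_mod_cast (by linarith [h x hx y hy] : y - 2 * ε ≤ x)
    rw [ha] at this
    have h3 : y - 2 * ε ≤ a := by exact_mod_cast this
    exact_mod_cast (by linarith : y ≤ a + 2 * ε)
  obtain ⟨b, hb⟩ : ∃ b : ℝ, hi S = b :=
    ⟨(hi S).toReal, (EReal.coe_toReal (ne_top_of_le_ne_top (EReal.coe_ne_top _) hle)
      (ne_bot_of_le_ne_bot (EReal.coe_ne_bot _) (le_hi hx₀))).symm⟩
  rw [ha, hb] at hS
  rw [hb] at hle
  have hab : a < b := by exact_mod_cast hS
  have hba : b ≤ a + 2 * ε := by exact_mod_cast hle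
  -- The midpoint works, since half the length is at most `ε`.
  refine ⟨(((a + b) / 2 : ℝ) : EReal), ?_, ?_⟩ <;> rw [Near]
  · rw [ha]
    norm_cast
    constructor <;> linarith [ε.2]
  · rw [hb]
    norm_cast
    constructor <;> linarith [ε.2]

/-! ### Stability of finite barcodes -/

section Stability

variable {ι : Type*} {p q : PersistenceFunction} {J J' : ι → Set ℝ}

/-- A bar goes to the bar with the same index when that one is close; otherwise it is short and goes
to a nearby diagonal point. Infinite diagonal multiplicity leaves room for these. -/
theorem exists_injection_of_shrinkLE [Finite ι] (hp : HasBars p J) (hJ : ∀ i, (J i).OrdConnected)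
    (hq : HasBars q J') (hJ' : ∀ i, (J' i).OrdConnected) {ε : ℝ≥0}
    (h : ∀ i, ShrinkLE ε (J i) (J' i)) (h' : ∀ i, ShrinkLE ε (J' i) (J i)) :
    ∃ f : p.Dgm → q.Dgm, Function.Injective f ∧
      ∀ c, Near ε c.1.1.1 (f c).1.1.1 ∧ Near ε c.1.1.2 (f c).1.1.2 := by
  classical
  obtain ⟨e, he1, he2⟩ := hp.exists_equiv hJ
  obtain ⟨e', he1', he2'⟩ := hq.exists_equiv hJ'
  obtain ⟨n, ⟨k⟩⟩ := Finite.exists_equiv_fin ι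
  let Good : ι → Prop := fun i =>
    lo (J' i) < hi (J' i) ∧ Near ε (lo (J i)) (lo (J' i)) ∧ Near ε (hi (J i)) (hi (J' i))
  have hbad : ∀ i, lo (J i) < hi (J i) → ¬ Good i →
      ∃ m : EReal, Near ε (lo (J i)) m ∧ Near ε (hi (J i)) m := by
    intro i hi hg
    refine exists_near_of_short hi fun x hx y hy => ?_
    by_contra hlt
    exact hg ((h i).near (h' i) hx hy (not_le.1 hlt))
  choose! m hm1 hm2 using hbad
  -- Copies of a diagonal point are shifted by `n`, which reserves the copy numbers below `n` for
  -- short bars, one for each index.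
  let g : {i // lo (J i) < hi (J i)} ⊕ (EReal × ℕ) → {i // lo (J' i) < hi (J' i)} ⊕ (EReal × ℕ) :=
    Sum.elim (fun i => if hi : Good i.1 then Sum.inl ⟨i.1, hi.1⟩ else Sum.inr (m i.1, (k i.1 : ℕ)))
      (fun d => Sum.inr (d.1, d.2 + n))
  have hg : Function.Injective g := by
    rintro (i | d) (j | d') hij
    · simp only [g, Sum.elim_inl] at hij
      split_ifs at hij with h1 h2 h2
      · simpa [Subtype.ext_iff] using hij
      · rw [Sum.inr.injEq, Prod.mk.injEq] at hij
        exact congrArg Sum.inl (Subtype.ext (k.injective (Fin.ext hij.2)))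
    · simp only [g, Sum.elim_inl, Sum.elim_inr] at hij
      split_ifs at hij
      have h2 := congrArg Prod.snd (Sum.inr.inj hij)
      have := (k i.1).is_lt
      simp only at h2
      omega
    · simp only [g, Sum.elim_inl, Sum.elim_inr] at hij
      split_ifs at hij
      have h2 := congrArg Prod.snd (Sum.inr.inj hij)
      have := (k j.1).is_lt
      simp only at h2
      omega
    · simpa [g, Prod.ext_iff] using hij
  refine ⟨fun c => e' (g (e.symm c)), e'.injective.comp (hg.comp e.symm.injective), fun c => ?_⟩
  obtain ⟨x, rfl⟩ := e.surjective c
  simp only [Equiv.symm_apply_apply]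
  rcases x with i | d
  · by_cases hi : Good i.1
    · simp only [g, Sum.elim_inl, dif_pos hi, he1, he1']
      exact hi.2
    · simp only [g, Sum.elim_inl, dif_neg hi, he1, he2']
      exact ⟨hm1 i.1 i.2 hi, hm2 i.1 i.2 hi⟩
  · simp only [g, Sum.elim_inr, he2, he2']
    exact ⟨Near.refl _ _, Near.refl _ _⟩

theorem bottleneckDist_le_of_shrinkLE [Finite ι] (hp : HasBars p J)
    (hJ : ∀ i, (J i).OrdConnected) (hq : HasBars q J') (hJ' : ∀ i, (J' i).OrdConnected) {ε : ℝ≥0}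
    (h : ∀ i, ShrinkLE ε (J i) (J' i)) (h' : ∀ i, ShrinkLE ε (J' i) (J i)) :
    bottleneckDist p q ≤ ε := by
  obtain ⟨f, hf, hfn⟩ := exists_injection_of_shrinkLE hp hJ hq hJ' h h'
  obtain ⟨g, hg, hgn⟩ := exists_injection_of_shrinkLE hq hJ' hp hJ h' h
  -- Each pair matched by `γ` comes from `f` or from the inverse of `g`, so it inherits the bound of
  -- that injection.
  obtain ⟨γ, hγ, hγn⟩ := Function.Embedding.schroeder_bernstein_of_rel hf hg
    (fun c d => Near ε c.1.1.1 d.1.1.1 ∧ Near ε c.1.1.2 d.1.1.2) hfn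
    (fun d => ⟨(hgn d).1.symm, (hgn d).2.symm⟩)
  refine iInf_le_of_le (Equiv.ofBijective γ hγ) (iSup_le fun c => ?_)
  exact max_le (hγn c).1.erealDist_le (hγn c).2.erealDist_le

end Stability

/-! ### Filtrations over a fixed object -/

section Cocone

variable {C : Type u} [Category.{v} C] {Φ : C ⥤ FinSetMono.{w}}

/-- The times at which the subset `B` of `Φ V` is a feature set of the filtration `F`,
with respect to maps `τ` from `F` to `V`. -/
def life (𝓕 : Feature Φ) (F : ℝ ⥤ C) {V : C} (τ : ∀ u, F.obj u ⟶ V)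
    (B : Set (Φ.obj V).carrier) : Set ℝ :=
  {u | ∃ A ∈ 𝓕.sets (F.obj u), push Φ (τ u) A = B}

/-- The least interval that contains the life of `B`. -/
def lifeHull (𝓕 : Feature Φ) (F : ℝ ⥤ C) {V : C} (τ : ∀ u, F.obj u ⟶ V)
    (B : Set (Φ.obj V).carrier) : Set ℝ :=
  {u | (∃ x ≤ u, x ∈ life 𝓕 F τ B) ∧ ∃ y ≥ u, y ∈ life 𝓕 F τ B}

theorem ordConnected_lifeHull (𝓕 : Feature Φ) (F : ℝ ⥤ C) {V : C} (τ : ∀ u, F.obj u ⟶ V)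
    (B : Set (Φ.obj V).carrier) : (lifeHull 𝓕 F τ B).OrdConnected := by
  refine ⟨?_⟩
  rintro a ⟨⟨x, hx, hxl⟩, -⟩ b ⟨-, y, hy, hyl⟩ c ⟨hac, hcb⟩
  exact ⟨⟨x, hx.trans hac, hxl⟩, y, hcb.trans hy, hyl⟩

variable (𝓕 : Feature Φ) {F : ℝ ⥤ C} {V : C} {τ : ∀ u, F.obj u ⟶ V}

theorem push_leg (hτ : ∀ (u v : ℝ) (h : u ≤ v), str F h ≫ τ v = τ u) {u v : ℝ} (h : u ≤ v)
    (A : Set (Φ.obj (F.obj u)).carrier) : push Φ (τ v) (push Φ (str F h) A) = push Φ (τ u) A := by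
  rw [push_push, hτ]

/-- Taking images in `V` is injective on subsets. Hence if `B` is hit by feature sets at two times,
the later one is the image of the earlier one. -/
theorem ncard_steadySets (hτ : ∀ (u v : ℝ) (h : u ≤ v), str F h ≫ τ v = τ u) {u v : ℝ}
    (huv : u ≤ v) : (steadySets 𝓕 F u v).ncard =
      {B | ∀ w, u ≤ w → w ≤ v → w ∈ life 𝓕 F τ B}.ncard := by
  rw [← Set.ncard_image_of_injective _ (push_injective Φ (τ u))]
  congr 1
  ext B
  constructor
  · rintro ⟨A, hA, rfl⟩ w hw hwv
    exact ⟨_, hA w hw hwv, push_leg hτ hw A⟩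
  · intro hB
    obtain ⟨A, hA, rfl⟩ := hB u le_rfl huv
    refine ⟨A, fun w hw hwv => ?_, rfl⟩
    obtain ⟨A', hA', h⟩ := hB w hw hwv
    rw [← push_leg hτ hw A] at h
    rwa [← push_injective Φ (τ w) h]

theorem ncard_rangingSets (hτ : ∀ (u v : ℝ) (h : u ≤ v), str F h ≫ τ v = τ u) {u v : ℝ}
    (huv : u ≤ v) : (rangingSets 𝓕 F u v).ncard =
      {B | (∃ x ≤ u, x ∈ life 𝓕 F τ B) ∧ ∃ y ≥ v, y ∈ life 𝓕 F τ B}.ncard := by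
  rw [← Set.ncard_image_of_injective _ (push_injective Φ (τ u))]
  congr 1
  ext B
  constructor
  · rintro ⟨A, ⟨x, y, hx, hv, hy, A', hA', rfl, hA⟩, rfl⟩
    exact ⟨⟨x, hx, A', hA', (push_leg hτ hx A').symm⟩, y, hv, _, hA, push_leg hτ hy _⟩
  · rintro ⟨⟨x, hx, A, hA, rfl⟩, y, hy, A', hA', h⟩
    refine ⟨push Φ (str F hx) A, ⟨x, y, hx, hy, huv.trans hy, A, hA, rfl, ?_⟩, push_leg hτ hx A⟩
    rw [← push_leg hτ hx A, ← push_leg hτ (huv.trans hy)] at h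
    rwa [← push_injective Φ (τ y) h]

theorem hasBars_rangingFunction (hτ : ∀ (u v : ℝ) (h : u ≤ v), str F h ≫ τ v = τ u) :
    HasBars (rangingFunction 𝓕 F) (lifeHull 𝓕 F τ) := by
  intro u v huv
  refine congrArg Nat.cast ((ncard_rangingSets 𝓕 hτ huv).trans (congrArg Set.ncard ?_))
  ext B
  constructor
  · rintro ⟨⟨x, hx, hxl⟩, y, hy, hyl⟩
    exact ⟨⟨⟨x, hx, hxl⟩, y, huv.trans hy, hyl⟩, ⟨x, hx.trans huv, hxl⟩, y, hy, hyl⟩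
  · rintro ⟨⟨h, -⟩, -, h'⟩
    exact ⟨h, h'⟩

theorem hasBars_steadyFunction (hτ : ∀ (u v : ℝ) (h : u ≤ v), str F h ≫ τ v = τ u)
    (hconv : ∀ B, (life 𝓕 F τ B).OrdConnected) :
    HasBars (steadyFunction 𝓕 F) (life 𝓕 F τ) := by
  intro u v huv
  refine congrArg Nat.cast ((ncard_steadySets 𝓕 hτ huv).trans (congrArg Set.ncard ?_))
  ext B
  exact ⟨fun h => ⟨h u le_rfl huv, h v huv le_rfl⟩,
    fun h w hw hwv => (hconv B).out h.1 h.2 ⟨hw, hwv⟩⟩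

end Cocone

/-! ### Step filtrations -/

section Step

/-- The step function with values `j₀`, `j₁`, `j₂`, `j₃` and jumps at `t₁`, `t₂`, `t₃`. -/
noncomputable def stepFun {P : Type*} (t₁ t₂ t₃ : ℝ) (j₀ j₁ j₂ j₃ : P) (x : ℝ) : P :=
  if x < t₁ then j₀ else if x < t₂ then j₁ else if x < t₃ then j₂ else j₃

theorem monotone_stepFun {P : Type*} [Preorder P] {t₁ t₂ t₃ : ℝ} {j₀ j₁ j₂ j₃ : P}
    (h₁ : j₀ ≤ j₁) (h₂ : j₁ ≤ j₂) (h₃ : j₂ ≤ j₃) :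
    Monotone (stepFun t₁ t₂ t₃ j₀ j₁ j₂ j₃) := by
  have h02 := h₁.trans h₂
  have h13 := h₂.trans h₃
  have h03 := h02.trans h₃
  intro x y hxy
  unfold stepFun
  split_ifs <;> first | assumption | exact le_rfl | (exfalso; linarith)

variable {C : Type u} [Category.{v} C]

/-- The filtration that runs through the objects of a diagram `K` at the times given by `m`. -/
def reindex {P : Type*} [Preorder P] (K : P ⥤ C) {m : ℝ → P} (hm : Monotone m) : ℝ ⥤ C :=
  hm.functor ⋙ K

theorem tame_reindex_stepFun {P : Type*} [Preorder P] (K : P ⥤ C) {t₁ t₂ t₃ : ℝ}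
    {j₀ j₁ j₂ j₃ : P} (hm : Monotone (stepFun t₁ t₂ t₃ j₀ j₁ j₂ j₃)) : Tame (reindex K hm) := by
  refine (Set.toFinite {t₁, t₂, t₃}).subset fun a ha => ?_
  by_contra hmem
  simp only [Set.mem_insert_iff, Set.mem_singleton_iff, not_or] at hmem
  have hev : ∀ t : ℝ, a ≠ t → ∀ᶠ x in nhds a, (x < t ↔ a < t) := by
    intro t hat
    rcases lt_or_gt_of_ne hat with h | h
    · filter_upwards [Iio_mem_nhds h] with x hx
      exact ⟨fun _ => h, fun _ => hx⟩
    · filter_upwards [Ioi_mem_nhds h] with x hx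
      exact ⟨fun h' => absurd h' (not_lt.2 hx.le), fun h' => absurd h' (not_lt.2 h.le)⟩
  have hloc : ∀ᶠ x in nhds a, stepFun t₁ t₂ t₃ j₀ j₁ j₂ j₃ x = stepFun t₁ t₂ t₃ j₀ j₁ j₂ j₃ a := by
    filter_upwards [hev t₁ hmem.1, hev t₂ hmem.2.1, hev t₃ hmem.2.2] with x h1 h2 h3
    simp only [stepFun, h1, h2, h3]
  obtain ⟨s, t, hst, hsub⟩ := mem_nhds_iff_exists_Ioo_subset.1 hloc
  obtain ⟨x, y, hxy, hx, hy, hiso⟩ := ha s t hst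
  refine hiso ?_
  have key : ∀ (i j : P) (f : i ⟶ j), i = j → IsIso (K.map f) := by
    rintro i _ f rfl
    rw [Subsingleton.elim f (𝟙 i), K.map_id]
    infer_instance
  exact key _ _ _ ((hsub hx).trans (hsub hy).symm)

/-- All diagrams over a preorder commute, so the inequalities between indices suffice. -/
theorem interleaved_reindex {P : Type*} [Preorder P] (K : P ⥤ C) {m m' : ℝ → P} (hm : Monotone m)
    (hm' : Monotone m') {ε : ℝ≥0} (h : ∀ x, m x ≤ m' (x + ε)) (h' : ∀ x, m' x ≤ m (x + ε)) :
    Interleaved ε (reindex K hm) (reindex K hm') := by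
  refine ⟨fun x => K.map (homOfLE (h x)), fun x => K.map (homOfLE (h' x)), ?_, ?_, ?_, ?_⟩
  · intro x hx
    exact (K.map_comp _ _).symm
  · intro x hx
    exact (K.map_comp _ _).symm
  · intro x y hx hy
    exact (K.map_comp (hm.functor.map (homOfLE hx)) (homOfLE (h y))).symm.trans
      (K.map_comp (homOfLE (h x)) (hm'.functor.map (homOfLE hy)))
  · intro x y hx hy
    exact (K.map_comp (hm'.functor.map (homOfLE hx)) (homOfLE (h' y))).symm.trans
      (K.map_comp (homOfLE (h' x)) (hm.functor.map (homOfLE hy)))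

end Step

/-! ### Balanced generators have convex features -/

section Convexity

variable {C : Type u} [Category.{v} C] {Φ : C ⥤ FinSetMono.{w}}

/-- The subset `B` of the last object comes from a feature set of the `j`-th object. -/
def Alive (𝓕 : Feature Φ) (K : Fin 6 ⥤ C) (j : Fin 6) (B : Set (Φ.obj (K.obj 5)).carrier) : Prop :=
  ∃ A ∈ 𝓕.sets (K.obj j), push Φ (K.map (homOfLE (Fin.le_last j))) A = B

theorem reindex_leg (K : Fin 6 ⥤ C) {m : ℝ → Fin 6} (hm : Monotone m) (u v : ℝ) (h : u ≤ v) :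
    str (reindex K hm) h ≫ K.map (homOfLE (Fin.le_last (m v))) =
      K.map (homOfLE (Fin.le_last (m u))) :=
  (K.map_comp _ _).symm

variable {𝓕 : Feature Φ}

theorem steady_count_le (hbal : (steadyGenerator 𝓕).TameBalanced) (K : Fin 6 ⥤ C)
    {m m' : ℝ → Fin 6} {hm : Monotone m} {hm' : Monotone m'} (ht : Tame (reindex K hm))
    (ht' : Tame (reindex K hm')) (h : ∀ x, m x ≤ m' (x + 1)) (h' : ∀ x, m' x ≤ m (x + 1))
    {u v : ℝ} (huv : u ≤ v) :
    {B | ∀ x, u - 1 ≤ x → x ≤ v + 1 → Alive 𝓕 K (m x) B}.ncard ≤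
      {B | ∀ x, u ≤ x → x ≤ v → Alive 𝓕 K (m' x) B}.ncard := by
  have hc := (hbal 1 _ _ ht ht' (interleaved_reindex K hm hm' h h') u v huv
    (by push_cast; linarith)).1
  have h1 := ncard_steadySets 𝓕 (reindex_leg K hm) (by linarith : u - 1 ≤ v + 1)
  have h2 := ncard_steadySets 𝓕 (reindex_leg K hm') huv
  exact h1.symm.trans_le ((Nat.cast_le (α := ℤ).1 hc).trans h2.le)

theorem ranging_count_le (hbal : (rangingGenerator 𝓕).TameBalanced) (K : Fin 6 ⥤ C)
    {m m' : ℝ → Fin 6} {hm : Monotone m} {hm' : Monotone m'} (ht : Tame (reindex K hm))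
    (ht' : Tame (reindex K hm')) (h : ∀ x, m x ≤ m' (x + 1)) (h' : ∀ x, m' x ≤ m (x + 1))
    {u v : ℝ} (huv : u ≤ v) :
    {B | (∃ x ≤ u - 1, Alive 𝓕 K (m x) B) ∧ ∃ y ≥ v + 1, Alive 𝓕 K (m y) B}.ncard ≤
      {B | (∃ x ≤ u, Alive 𝓕 K (m' x) B) ∧ ∃ y ≥ v, Alive 𝓕 K (m' y) B}.ncard := by
  have hc := (hbal 1 _ _ ht ht' (interleaved_reindex K hm hm' h h') u v huv
    (by push_cast; linarith)).1
  have h1 := ncard_rangingSets 𝓕 (reindex_leg K hm) (by linarith : u - 1 ≤ v + 1)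
  have h2 := ncard_rangingSets 𝓕 (reindex_leg K hm') huv
  exact h1.symm.trans_le ((Nat.cast_le (α := ℤ).1 hc).trans h2.le)

/-- One filtration jumps from object 1 to object 3, the other pauses at object 2. Balancedness
bounds the number of sets alive at 1 and 3 by the number alive at 1, 2 and 3, so the two families
coincide. -/
theorem steady_convex (hbal : (steadyGenerator 𝓕).TameBalanced) (K : Fin 6 ⥤ C)
    {B : Set (Φ.obj (K.obj 5)).carrier} (h1 : Alive 𝓕 K 1 B) (h3 : Alive 𝓕 K 3 B) :
    Alive 𝓕 K 2 B := by
  -- Object 2 occupies `[-1, 1)` around the jump at `0`, as a shift by `1` permits. The intervals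
  -- `[-3, 3]` and `[-2, 2]` then meet every step of their filtrations.
  have hm : Monotone (stepFun 0 0 0 1 3 3 3 : ℝ → Fin 6) :=
    monotone_stepFun (by decide) (by decide) (by decide)
  have hm' : Monotone (stepFun (-1) 1 1 1 2 3 3 : ℝ → Fin 6) :=
    monotone_stepFun (by decide) (by decide) (by decide)
  have hle := steady_count_le hbal K (tame_reindex_stepFun K hm) (tame_reindex_stepFun K hm')
    (fun x => by
      unfold stepFun
      split_ifs <;> first | decide | (exfalso; linarith))
    (fun x => by
      unfold stepFun
      split_ifs <;> first | decide | (exfalso; linarith)) (by norm_num : (-2 : ℝ) ≤ 2)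
  have heq := Set.eq_of_subset_of_ncard_le (fun A hA x hx hx' => ?_) hle (Set.toFinite _)
  · have hB : B ∈ {B | ∀ x : ℝ, -2 - 1 ≤ x → x ≤ 2 + 1 →
        Alive 𝓕 K (stepFun 0 0 0 1 3 3 3 x) B} := by
      intro x _ _
      unfold stepFun
      split_ifs <;> assumption
    rw [← heq] at hB
    have := hB 0 (by norm_num) (by norm_num)
    norm_num [stepFun] at this
    exact this
  · have ha := hA (-2) (by norm_num) (by norm_num)
    have hb := hA 2 (by norm_num) (by norm_num)
    norm_num [stepFun] at ha hb
    unfold stepFun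
    split_ifs <;> assumption

/-- The second filtration omits object 1. Balancedness says that this loses no set alive at 3 and at
one of 0, 1, 2, so such a set is already alive at 0 or 2. -/
theorem ranging_alive_birth (hbal : (rangingGenerator 𝓕).TameBalanced) (K : Fin 6 ⥤ C)
    {B : Set (Φ.obj (K.obj 5)).carrier} (h1 : Alive 𝓕 K 1 B) (h3 : Alive 𝓕 K 3 B) :
    Alive 𝓕 K 2 B ∨ Alive 𝓕 K 0 B := by
  -- The window `[0, 2)` of object 1 is split at `1` between objects 0 and 2. With `u = 3`, the
  -- times `x ≤ u - 1` just reach object 2 at `x = 2`, which the inclusion of the two families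
  -- needs. With `v = 10`, only object 3 remains on the right.
  have hm : Monotone (stepFun 0 2 10 0 1 2 3 : ℝ → Fin 6) :=
    monotone_stepFun (by decide) (by decide) (by decide)
  have hm' : Monotone (stepFun 1 1 10 0 2 2 3 : ℝ → Fin 6) :=
    monotone_stepFun (by decide) (by decide) (by decide)
  have hle := ranging_count_le hbal K (tame_reindex_stepFun K hm) (tame_reindex_stepFun K hm')
    (fun x => by
      unfold stepFun
      split_ifs <;> first | decide | (exfalso; linarith))
    (fun x => by
      unfold stepFun
      split_ifs <;> first | decide | (exfalso; linarith)) (by norm_num : (3 : ℝ) ≤ 10)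
  have heq := Set.eq_of_subset_of_ncard_le ?_ hle (Set.toFinite _)
  · have hB : B ∈ {B | (∃ x ≤ (3 - 1 : ℝ), Alive 𝓕 K (stepFun 0 2 10 0 1 2 3 x) B) ∧
        ∃ y ≥ (10 + 1 : ℝ), Alive 𝓕 K (stepFun 0 2 10 0 1 2 3 y) B} :=
      ⟨⟨0, by norm_num, by norm_num [stepFun]; exact h1⟩, 11, by norm_num,
        by norm_num [stepFun]; exact h3⟩
    rw [← heq] at hB
    obtain ⟨⟨x, hx, hxB⟩, -⟩ := hB
    unfold stepFun at hxB
    split_ifs at hxB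
    · exact Or.inr hxB
    · exact Or.inl hxB
    · exfalso; linarith
  · rintro A ⟨⟨x, hx, hxA⟩, y, hy, hyA⟩
    constructor
    · unfold stepFun at hxA
      split_ifs at hxA
      · exact ⟨-1, by norm_num, by norm_num [stepFun]; exact hxA⟩
      · exact ⟨2, by norm_num, by norm_num [stepFun]; exact hxA⟩
      · exfalso; linarith
    · refine ⟨11, by norm_num, ?_⟩
      unfold stepFun at hyA
      split_ifs at hyA <;> first | (exfalso; linarith) | (norm_num [stepFun]; exact hyA)

/-- The mirror image at the right end: object 3 is omitted, and a set alive at 1 and 3 must survive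
at 2 or 4. -/
theorem ranging_alive_death (hbal : (rangingGenerator 𝓕).TameBalanced) (K : Fin 6 ⥤ C)
    {B : Set (Φ.obj (K.obj 5)).carrier} (h1 : Alive 𝓕 K 1 B) (h3 : Alive 𝓕 K 3 B) :
    Alive 𝓕 K 2 B ∨ Alive 𝓕 K 4 B := by
  -- The window `[10, 12)` of object 3 is split at `11` between objects 2 and 4. The choice `u = -1`
  -- leaves only object 1 on the left, and `v = 8` keeps objects 2 and 4 in view on the right in
  -- both filtrations.
  have hm : Monotone (stepFun 0 10 12 1 2 3 4 : ℝ → Fin 6) :=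
    monotone_stepFun (by decide) (by decide) (by decide)
  have hm' : Monotone (stepFun 0 11 11 1 2 4 4 : ℝ → Fin 6) :=
    monotone_stepFun (by decide) (by decide) (by decide)
  have hle := ranging_count_le hbal K (tame_reindex_stepFun K hm) (tame_reindex_stepFun K hm')
    (fun x => by
      unfold stepFun
      split_ifs <;> first | decide | (exfalso; linarith))
    (fun x => by
      unfold stepFun
      split_ifs <;> first | decide | (exfalso; linarith)) (by norm_num : (-1 : ℝ) ≤ 8)
  have heq := Set.eq_of_subset_of_ncard_le ?_ hle (Set.toFinite _)
  · have hB : B ∈ {B | (∃ x ≤ (-1 - 1 : ℝ), Alive 𝓕 K (stepFun 0 10 12 1 2 3 4 x) B) ∧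
        ∃ y ≥ (8 + 1 : ℝ), Alive 𝓕 K (stepFun 0 10 12 1 2 3 4 y) B} :=
      ⟨⟨-2, by norm_num, by norm_num [stepFun]; exact h1⟩, 10, by norm_num,
        by norm_num [stepFun]; exact h3⟩
    rw [← heq] at hB
    obtain ⟨-, y, hy, hyB⟩ := hB
    unfold stepFun at hyB
    split_ifs at hyB
    · exfalso; linarith
    · exact Or.inl hyB
    · exact Or.inr hyB
  · rintro A ⟨⟨x, hx, hxA⟩, y, hy, hyA⟩
    constructor
    · refine ⟨-2, by norm_num, ?_⟩
      unfold stepFun at hxA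
      split_ifs at hxA <;> first | (exfalso; linarith) | (norm_num [stepFun]; exact hxA)
    · unfold stepFun at hyA
      split_ifs at hyA
      · exfalso; linarith
      · exact ⟨9, by norm_num, by norm_num [stepFun]; exact hyA⟩
      · exact ⟨12, by norm_num, by norm_num [stepFun]; exact hyA⟩

end Convexity

/-! ### Convexity for chains of morphisms and for shifted maps over `V` -/

section Chains

variable {C : Type u} [Category.{v} C] {Φ : C ⥤ FinSetMono.{w}} {𝓕 : Feature Φ}

/-- The subset `B` of `Φ V` comes, along `f : X ⟶ V`, from a feature set of `X`. -/
def ComesFrom (𝓕 : Feature Φ) {X V : C} (f : X ⟶ V) (B : Set (Φ.obj V).carrier) : Prop :=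
  ∃ A ∈ 𝓕.sets X, push Φ f A = B

theorem steady_convex_chain (hbal : (steadyGenerator 𝓕).TameBalanced) {X₁ X₂ X₃ V : C}
    (f₁ : X₁ ⟶ X₂) (f₂ : X₂ ⟶ X₃) (f₃ : X₃ ⟶ V) {B : Set (Φ.obj V).carrier}
    (h1 : ComesFrom 𝓕 (f₁ ≫ f₂ ≫ f₃) B) (h3 : ComesFrom 𝓕 f₃ B) : ComesFrom 𝓕 (f₂ ≫ f₃) B := by
  have := steady_convex hbal (ComposableArrows.mk₅ (𝟙 X₁) f₁ f₂ f₃ (𝟙 V)) (B := B)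
  -- The chain is padded by identities at both ends, so its maps to the last object end in `𝟙 V`.
  rw [← Category.comp_id f₃] at h1 h3 ⊢
  exact this h1 h3

theorem ranging_convex_chain (hbal : (rangingGenerator 𝓕).TameBalanced) {X₀ X₁ X₂ X₃ X₄ V : C}
    (f₀ : X₀ ⟶ X₁) (f₁ : X₁ ⟶ X₂) (f₂ : X₂ ⟶ X₃) (f₃ : X₃ ⟶ X₄) (f₄ : X₄ ⟶ V)
    {B : Set (Φ.obj V).carrier} (h1 : ComesFrom 𝓕 (f₁ ≫ f₂ ≫ f₃ ≫ f₄) B)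
    (h3 : ComesFrom 𝓕 (f₃ ≫ f₄) B) :
    ComesFrom 𝓕 (f₂ ≫ f₃ ≫ f₄) B ∨
      (ComesFrom 𝓕 (f₀ ≫ f₁ ≫ f₂ ≫ f₃ ≫ f₄) B ∧ ComesFrom 𝓕 f₄ B) := by
  have hb : ComesFrom 𝓕 (f₂ ≫ f₃ ≫ f₄) B ∨ ComesFrom 𝓕 (f₀ ≫ f₁ ≫ f₂ ≫ f₃ ≫ f₄) B :=
    ranging_alive_birth hbal (ComposableArrows.mk₅ f₀ f₁ f₂ f₃ f₄) (B := B) h1 h3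
  have hd : ComesFrom 𝓕 (f₂ ≫ f₃ ≫ f₄) B ∨ ComesFrom 𝓕 f₄ B :=
    ranging_alive_death hbal (ComposableArrows.mk₅ f₀ f₁ f₂ f₃ f₄) (B := B) h1 h3
  tauto

/-! ### Shifted maps over a fixed object -/

variable {F G : ℝ ⥤ C} {V : C} {τ : ∀ u, F.obj u ⟶ V} {σ : ∀ u, G.obj u ⟶ V} {ε : ℝ≥0}

/-- There are maps `F u ⟶ G v` over `V` whenever `u + ε ≤ v`. -/
def Shifts (ε : ℝ≥0) (τ : ∀ u, F.obj u ⟶ V) (σ : ∀ u, G.obj u ⟶ V) : Prop :=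
  ∀ u v : ℝ, u + ε ≤ v → ∃ f : F.obj u ⟶ G.obj v, f ≫ σ v = τ u

theorem Shifts.steady_shrinkLE (hbal : (steadyGenerator 𝓕).TameBalanced) (h : Shifts ε τ σ)
    (h' : Shifts ε σ τ) (B : Set (Φ.obj V).carrier) :
    ShrinkLE ε (life 𝓕 F τ B) (life 𝓕 G σ B) := by
  intro x hx y hy z hxz hzy
  obtain ⟨f, hf⟩ := h x z hxz
  obtain ⟨g, hg⟩ := h' z y (by linarith)
  have := steady_convex_chain hbal f g (τ y) (B := B)
  simp only [hg, hf] at this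
  exact this hx hy

theorem ordConnected_life (hbal : (steadyGenerator 𝓕).TameBalanced)
    (hτ : ∀ (u v : ℝ) (h : u ≤ v), str F h ≫ τ v = τ u) (B : Set (Φ.obj V).carrier) :
    (life 𝓕 F τ B).OrdConnected := by
  -- Convexity of a life is the shrinking statement for `F` against itself with `ε = 0`.
  have hs : Shifts 0 τ τ := fun u v h => ⟨str F (by simpa using h), hτ _ _ _⟩
  exact ⟨fun x hx y hy z hz => hs.steady_shrinkLE hbal hs B x hx y hy z (by simpa using hz.1)
    (by simpa using hz.2)⟩

/-- The chain `G (x - ε) ⟶ F x ⟶ G z ⟶ F y ⟶ G (y + ε)` lies over `V`. If `B` is not alive at `G z`,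
it is alive at both outer objects, and then `z` lies in the hull anyway. -/
theorem Shifts.ranging_shrinkLE (hbal : (rangingGenerator 𝓕).TameBalanced) (h : Shifts ε τ σ)
    (h' : Shifts ε σ τ) (B : Set (Φ.obj V).carrier) :
    ShrinkLE ε (lifeHull 𝓕 F τ B) (lifeHull 𝓕 G σ B) := by
  rintro x' ⟨⟨x, hx, hxl⟩, -⟩ y' ⟨-, y, hy, hyl⟩ z hxz hzy
  have hε : (0 : ℝ) ≤ ε := ε.2
  obtain ⟨f₀, hf₀⟩ := h' (x - ε) x (by linarith)
  obtain ⟨f₁, hf₁⟩ := h x z (by linarith)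
  obtain ⟨f₂, hf₂⟩ := h' z y (by linarith)
  obtain ⟨f₃, hf₃⟩ := h y (y + ε) le_rfl
  have := ranging_convex_chain hbal f₀ f₁ f₂ f₃ (σ (y + ε)) (B := B)
  simp only [hf₃, hf₂, hf₁, hf₀] at this
  rcases this hxl hyl with hz | ⟨ha, hb⟩
  · exact ⟨⟨z, le_rfl, hz⟩, z, le_rfl, hz⟩
  · exact ⟨⟨x - ε, by linarith, ha⟩, y + ε, by linarith, hb⟩

end Chains

/-! ### A common target for interleaved tame filtrations -/

section Target

variable {C : Type u} [Category.{v} C]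

theorem str_comp (F : ℝ ⥤ C) {a b c : ℝ} (h : a ≤ b) (h' : b ≤ c) :
    str F h ≫ str F h' = str F (h.trans h') :=
  (F.map_comp _ _).symm

/-- Near a noncritical point all structure maps are isomorphisms. By two-out-of-three this is an
equivalence relation between times, and connectedness of the interval carries it from `a` to `b`. -/
theorem isIso_str_of_forall {F : ℝ ⥤ C} {a b : ℝ} (hab : a ≤ b)
    (h : ∀ x ∈ Set.Icc a b, ¬ IsCritical F x) : IsIso (str F hab) := by
  let P : ℝ → ℝ → Prop := fun x y =>
    (∀ h : x ≤ y, IsIso (str F h)) ∧ ∀ h : y ≤ x, IsIso (str F h)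
  have htri : ∀ x y z : ℝ, P x y → P y z → ∀ h : x ≤ z, IsIso (str F h) := by
    intro x y z hxy hyz hxz
    rcases le_total x y with h1 | h1
    · rcases le_total y z with h2 | h2
      · have := hxy.1 h1
        have := hyz.1 h2
        rw [← str_comp F h1 h2]
        infer_instance
      · have h3 := hyz.2 h2
        have h4 := hxy.1 h1
        rw [← str_comp F hxz h2] at h4
        exact IsIso.of_isIso_comp_right (str F hxz) (str F h2)
    · have h3 := hxy.2 h1
      have h4 := hyz.1 (h1.trans hxz)
      rw [← str_comp F h1 hxz] at h4
      exact IsIso.of_isIso_comp_left (str F h1) (str F hxz)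
  have hsymm : ∀ x y : ℝ, P x y → P y x := fun x y h => ⟨h.2, h.1⟩
  refine (isPreconnected_Icc.induction₂ P (fun x hx => ?_) (fun x y z _ _ _ hxy hyz => ?_)
    (fun x y _ _ => hsymm x y) (Set.left_mem_Icc.2 hab) (Set.right_mem_Icc.2 hab)).1 hab
  · have hc := h x hx
    unfold IsCritical at hc
    push Not at hc
    obtain ⟨s, t, hst, hiso⟩ := hc
    filter_upwards [mem_nhdsWithin_of_mem_nhds (Ioo_mem_nhds hst.1 hst.2)] with y hy
    exact ⟨fun h => hiso x y h hst hy, fun h => hiso y x h hy hst⟩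
  · exact ⟨htri x y z hxy hyz, htri z y x (hsymm _ _ hyz) (hsymm _ _ hxy)⟩

theorem Tame.exists_forall_isIso {F : ℝ ⥤ C} (hF : Tame F) :
    ∃ M : ℝ, ∀ (u v : ℝ) (_ : M ≤ u) (h : u ≤ v), IsIso (str F h) := by
  obtain ⟨M, hM⟩ := hF.bddAbove
  refine ⟨M + 1, fun u v hu huv => isIso_str_of_forall huv fun x hx hc => ?_⟩
  have := hM hc
  linarith [hx.1]

/-- A tame filtration maps to its final object. -/
theorem Tame.exists_cocone {F : ℝ ⥤ C} (hF : Tame F) :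
    ∃ (V : C) (τ : ∀ u, F.obj u ⟶ V), ∀ (u v : ℝ) (h : u ≤ v), str F h ≫ τ v = τ u := by
  obtain ⟨M, hM⟩ := hF.exists_forall_isIso
  -- The leg at `u` goes forward to `max u M` and back along this isomorphism to `M`.
  have hiso : ∀ u, IsIso (str F (le_max_right u M)) := fun u => hM _ _ le_rfl _
  refine ⟨F.obj M, fun u => str F (le_max_left u M) ≫ inv (str F (le_max_right u M)), ?_⟩
  intro u v h
  have hle : max u M ≤ max v M := max_le_max_right M h
  have h1 : inv (str F (le_max_right u M)) = str F hle ≫ inv (str F (le_max_right v M)) := by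
    rw [IsIso.inv_eq_of_hom_inv_id]
    rw [← Category.assoc, str_comp, IsIso.hom_inv_id]
  dsimp only
  rw [h1, ← Category.assoc, ← Category.assoc, str_comp, str_comp]

/-- `G` reaches the final object of `F` through `ψ`. The triangle `φ` followed by `ψ` shows that `φ`
also commutes with the maps to `V`. -/
theorem Interleaved.exists_shifts {ε : ℝ≥0} {F G : ℝ ⥤ C} (hF : Tame F)
    (h : Interleaved ε F G) :
    ∃ (V : C) (τ : ∀ u, F.obj u ⟶ V) (σ : ∀ u, G.obj u ⟶ V),
      (∀ (u v : ℝ) (h : u ≤ v), str F h ≫ τ v = τ u) ∧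
      (∀ (u v : ℝ) (h : u ≤ v), str G h ≫ σ v = σ u) ∧ Shifts ε τ σ ∧ Shifts ε σ τ := by
  obtain ⟨V, τ, hτ⟩ := hF.exists_cocone
  obtain ⟨φ, ψ, hφψ, -, -, hψ⟩ := h
  have hε : (0 : ℝ) ≤ ε := ε.2
  have hσ : ∀ (u v : ℝ) (h : u ≤ v), str G h ≫ ψ v ≫ τ (v + ε) = ψ u ≫ τ (u + ε) := by
    intro u v h
    have h' : u + ε ≤ v + ε := by linarith
    rw [← Category.assoc, hψ u v h h', Category.assoc, hτ]
  refine ⟨V, τ, fun u => ψ u ≫ τ (u + ε), hτ, hσ, fun u v huv => ?_, fun u v huv => ?_⟩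
  · refine ⟨φ u ≫ str G huv, ?_⟩
    have h' : u ≤ u + ε + ε := by linarith
    rw [Category.assoc, hσ, ← Category.assoc, hφψ u h', hτ]
  · exact ⟨ψ u ≫ str F huv, by rw [Category.assoc, hτ]⟩

end Target

end SteadyRanging

theorem mainTheorem2 {C : Type u} [Category.{v} C] (hC : SteadyRanging.IsMonoCategory C)
    (Φ : C ⥤ SteadyRanging.FinSetMono.{w}) (hΦ : Φ.Faithful)
    (hempty : ∃ E : C, SteadyRanging.IsEmptyLike Φ E)
    (htriangle : SteadyRanging.TriangleCondition Φ)
    (𝓕 : SteadyRanging.Feature Φ) (π : SteadyRanging.IpGenerator C)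
    (hπ : π = SteadyRanging.steadyGenerator 𝓕 ∨ π = SteadyRanging.rangingGenerator 𝓕)
    (hbal : π.TameBalanced) :
    π.TameStable := by
  intro F G hF _
  refine le_iInf₂ fun ε hε => ?_
  obtain ⟨V, τ, σ, hτ, hσ, h, h'⟩ := hε.exists_shifts hF
  rcases hπ with rfl | rfl
  · have hJ := SteadyRanging.ordConnected_life hbal hτ
    have hJ' := SteadyRanging.ordConnected_life hbal hσ
    exact SteadyRanging.bottleneckDist_le_of_shrinkLE
      (SteadyRanging.hasBars_steadyFunction 𝓕 hτ hJ) hJ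
      (SteadyRanging.hasBars_steadyFunction 𝓕 hσ hJ') hJ'
      (h.steady_shrinkLE hbal h') (h'.steady_shrinkLE hbal h)
  · exact SteadyRanging.bottleneckDist_le_of_shrinkLE
      (SteadyRanging.hasBars_rangingFunction 𝓕 hτ) (SteadyRanging.ordConnected_lifeHull 𝓕 F τ)
      (SteadyRanging.hasBars_rangingFunction 𝓕 hσ) (SteadyRanging.ordConnected_lifeHull 𝓕 G σ)
      (h.ranging_shrinkLE hbal h') (h'.ranging_shrinkLE hbal h)
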